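/- Let $m,n\ge 0$ be integers, let $p>0$ and $\lambda>0$ be real numbers, and let $$E=E(m,n,p)=\{(z,w)\in\mathbb{C}^n\times\mathbb{C}^m : |z|^2+|w|^{2p}<1\}$$ be the complex ellipsoid, where $|\cdot|$ is the Euclidean norm. On $E$ put $$X=|w|^2(1-|z|^2)^{-1/p},\qquad N=\frac{(n+1)p+m}{p},\qquad K=(1-X)^{-\lambda}(1-|z|^2)^{-N},$$ and let $Y$ be the metric on $E$ with potential $\log K$ (W. Yin's metric), i.e. with components $$g_{a\bar b}=\frac{\partial^2\log K}{\partial\zeta_a\,\partial\bar\zeta_b}$$ in the coordinates $\zeta=(z,w)$ of $\mathbb{C}^{n+m}$. Then $\log K$ is smooth on $E$ and $(g_{a\bar b})$ is positive definite at every point of $E$, so that $Y$ is a Kähler metric, and there exists $D>0$ (which may depend on $m,n,p,\lambda$) such that the holomorphic sectional curvature of $Y$ is bounded below by $-D$: at every point of $E$ and for every non-zero $\xi\in\mathbb{C}^{n+m}$, $$h(\xi)=\frac{2\sum_{a,b,c,d}R_{a\bar bc\bar d}\,\xi_a\bar\xi_b\xi_c\bar\xi_d}{\bigl(\sum_{a,b}g_{a\bar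 b}\,\xi_a\bar\xi_b\bigr)^2}\ \ge\ -D,$$ where $$R_{a\bar bc\bar d}=-\frac{\partial^2 g_{a\bar b}}{\partial\zeta_c\,\partial\bar\zeta_d}+\sum_{r,s}g^{s\bar r}\,\frac{\partial g_{a\bar r}}{\partial\zeta_c}\,\frac{\partial g_{s\bar b}}{\partial\bar\zeta_d},\qquad \sum_r g^{s\bar r}g_{t\bar r}=\delta_{st}.$$ -/

import Mathlib

open scoped ContDiff ComplexOrder

noncomputable section

namespace Ellipsoid

variable {ι : Type} [Fintype ι] [DecidableEq ι]

/-- The operator `∂/∂z_a = (∂/∂x_a - i ∂/∂y_a) / 2` on complex-valued functions on `ℂ^ι`. -/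
def wirt (a : ι) (f : (ι → ℂ) → ℂ) (ζ : ι → ℂ) : ℂ :=
  (fderiv ℝ f ζ (Pi.single a 1) - Complex.I * fderiv ℝ f ζ (Pi.single a Complex.I)) / 2

/-- The operator `∂/∂z̄_a = (∂/∂x_a + i ∂/∂y_a) / 2` on complex-valued functions on `ℂ^ι`. -/
def wirtBar (a : ι) (f : (ι → ℂ) → ℂ) (ζ : ι → ℂ) : ℂ :=
  (fderiv ℝ f ζ (Pi.single a 1) + Complex.I * fderiv ℝ f ζ (Pi.single a Complex.I)) / 2

/-- The matrix `g_{a b̄} = ∂² φ / ∂z_a ∂z̄_b` of the metric with potential `φ`. -/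
def metric (φ : (ι → ℂ) → ℝ) (ζ : ι → ℂ) : Matrix ι ι ℂ :=
  Matrix.of fun a b => wirt a (wirtBar b fun x => (φ x : ℂ)) ζ

/-- `φ` is a smooth potential of a Kähler metric on `Ω`: the Hermitian form
`(∂² φ / ∂z_a ∂z̄_b)` is positive definite at every point of `Ω`. -/
def IsKahlerPotentialOn (φ : (ι → ℂ) → ℝ) (Ω : Set (ι → ℂ)) : Prop :=
  ContDiffOn ℝ ∞ φ Ω ∧ ∀ ζ ∈ Ω, (metric φ ζ).PosDef

/-- The curvature components
`R_{a b̄ c d̄} = - ∂² g_{a b̄} / ∂z_c ∂z̄_d + ∑_{p,q} g^{q p̄} (∂ g_{a p̄} / ∂z_c) (∂ g_{q b̄} / ∂z̄_d)`,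
where `g^{q p̄}` is determined by `∑_p g^{q p̄} g_{r p̄} = δ_{q r}`; that is, `g^{q p̄}` is the
`(p, q)` entry of the inverse of the matrix `(g_{a b̄})`. -/
def curvature (g : (ι → ℂ) → Matrix ι ι ℂ) (ζ : ι → ℂ) (a b c d : ι) : ℂ :=
  -wirt c (wirtBar d fun x => g x a b) ζ +
    ∑ p, ∑ q, (g ζ)⁻¹ p q * wirt c (fun x => g x a p) ζ * wirtBar d (fun x => g x q b) ζ

/-- The squared length `g(ξ, ξ̄) = ∑ g_{a b̄} ξ_a ξ̄_b`. -/
def sqLength (g : (ι → ℂ) → Matrix ι ι ℂ) (ζ ξ : ι → ℂ) : ℂ :=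
  ∑ a, ∑ b, g ζ a b * ξ a * star (ξ b)

/-- The holomorphic sectional curvature `2 R_{ξ ξ̄ ξ ξ̄} / g(ξ, ξ̄)²` of `g` at the point `ζ` in the
holomorphic tangent direction `ξ`. For a Kähler metric the quotient is a real number. -/
def holSectCurvature (g : (ι → ℂ) → Matrix ι ι ℂ) (ζ ξ : ι → ℂ) : ℝ :=
  (2 * (∑ a, ∑ b, ∑ c, ∑ d, curvature g ζ a b c d * ξ a * star (ξ b) * ξ c * star (ξ d)) /
    sqLength g ζ ξ ^ 2).re

/-- The Euclidean norm of the component `z ∈ ℂ^n` of a point `(z, w) ∈ ℂ^n × ℂ^m`. -/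
def normZ {m n : ℕ} (ζ : Fin n ⊕ Fin m → ℂ) : ℝ := ‖WithLp.toLp 2 fun i => ζ (Sum.inl i)‖

/-- The Euclidean norm of the component `w ∈ ℂ^m` of a point `(z, w) ∈ ℂ^n × ℂ^m`. -/
def normW {m n : ℕ} (ζ : Fin n ⊕ Fin m → ℂ) : ℝ := ‖WithLp.toLp 2 fun j => ζ (Sum.inr j)‖

/-- The complex ellipsoid `E(m,n,p) = {(z, w) ∈ ℂ^n × ℂ^m : |z|² + |w|^{2p} < 1}`. -/
def ellipsoid (m n : ℕ) (p : ℝ) : Set (Fin n ⊕ Fin m → ℂ) :=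
  {ζ | normZ ζ ^ 2 + normW ζ ^ (2 * p) < 1}

/-- The function `X(z, w) = |w|² (1 - |z|²)^{-1/p}`. -/
def yinX {m n : ℕ} (p : ℝ) (ζ : Fin n ⊕ Fin m → ℂ) : ℝ :=
  normW ζ ^ 2 * (1 - normZ ζ ^ 2) ^ (-1 / p)

/-- The generating function `K = (1 - X)^{-lam} (1 - |z|²)^{-N}` with `N = ((n + 1) p + m) / p`. -/
def yinK (m n : ℕ) (p lam : ℝ) (ζ : Fin n ⊕ Fin m → ℂ) : ℝ :=
  (1 - yinX p ζ) ^ (-lam) * (1 - normZ ζ ^ 2) ^ (-(((n + 1 : ℝ) * p + m) / p))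

/-- The potential `log K` of Yin's metric. -/
def yinPotential (m n : ℕ) (p lam : ℝ) (ζ : Fin n ⊕ Fin m → ℂ) : ℝ :=
  Real.log (yinK m n p lam ζ)

end Ellipsoid

end

/-! With `ξ` fixed, `R(ξ, ξ̄, ξ, ξ̄)` equals `-∂_ξ ∂̄_ξ g(ξ, ξ̄)` plus a term quadratic in the first
derivatives of the metric. That term is a squared length for the inverse metric, hence nonnegative
(`curvature_quadratic_part_nonneg`), so a lower curvature bound follows from `|∂_ξ ∂̄_ξ g(ξ, ξ̄)| ≤
C g(ξ, ξ̄)²` (`le_holSectCurvature`).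

On `E` the potential is `-λ log (1 - X) - N log (1 - |z|²)`. Its derivatives along `ξ` are
polynomials in a few invariants: the logarithmic derivatives `beta`, `gamma` (weight one) and
`hessU`, `vert`, `kap * hessU`, `kap * beta ^ 2` (weight two). These polynomials are closed under
`∂_ξ` and `∂̄_ξ`, each raising the weight by one, with coefficients depending only on the parameters
(`YinPoly.exists_hasWirt`). An invariant of weight `k` is bounded by the `k`-th power of `√yinSize`
(`YinPoly.exists_bound`), and `g(ξ, ξ̄)` dominates a constant times `yinSize`
(`exists_yinLength_eq`). The fourth derivative has weight four, so it is bounded by a constant times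
`g(ξ, ξ̄)²`, uniformly up to the boundary and without computing it. -/

noncomputable section

namespace Ellipsoid

/-! ### Wirtinger calculus along a fixed direction. -/

section Wirtinger

variable {ι : Type} [Fintype ι] [DecidableEq ι]

/-- The `(1, 0)`-part `∑ ξ_a ∂f/∂z_a` of the derivative of `f` in the direction `ξ`. -/
def wirtDir (ξ : ι → ℂ) (f : (ι → ℂ) → ℂ) (ζ : ι → ℂ) : ℂ := ∑ a, ξ a * wirt a f ζ

/-- The `(0, 1)`-part `∑ ξ̄_a ∂f/∂z̄_a` of the derivative of `f` in the direction `ξ`. -/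
def wirtBarDir (ξ : ι → ℂ) (f : (ι → ℂ) → ℂ) (ζ : ι → ℂ) : ℂ := ∑ a, star (ξ a) * wirtBar a f ζ

/-- `f` is real differentiable at `ζ`, with `(1, 0)`- and `(0, 1)`-parts `d` and `d'` of its
derivative in the direction `ξ`. -/
structure HasWirt (ξ : ι → ℂ) (f : (ι → ℂ) → ℂ) (d d' : ℂ) (ζ : ι → ℂ) : Prop where
  differentiableAt : DifferentiableAt ℝ f ζ
  wirtDir_eq : wirtDir ξ f ζ = d
  wirtBarDir_eq : wirtBarDir ξ f ζ = d'

variable {ξ ζ : ι → ℂ} {f g : (ι → ℂ) → ℂ} {d d' k k' : ℂ}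

theorem wirt_congr {κ : Type} [DecidableEq κ] {f g : (κ → ℂ) → ℂ} {ζ : κ → ℂ} (a : κ)
    (h : f =ᶠ[nhds ζ] g) : wirt a f ζ = wirt a g ζ := by
  simp only [wirt, h.fderiv_eq]

theorem wirtBar_congr {κ : Type} [DecidableEq κ] {f g : (κ → ℂ) → ℂ} {ζ : κ → ℂ} (a : κ)
    (h : f =ᶠ[nhds ζ] g) : wirtBar a f ζ = wirtBar a g ζ := by
  simp only [wirtBar, h.fderiv_eq]

theorem wirtDir_congr (h : f =ᶠ[nhds ζ] g) : wirtDir ξ f ζ = wirtDir ξ g ζ := by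
  simp only [wirtDir, wirt_congr _ h]

theorem wirtBarDir_congr (h : f =ᶠ[nhds ζ] g) : wirtBarDir ξ f ζ = wirtBarDir ξ g ζ := by
  simp only [wirtBarDir, wirtBar_congr _ h]

namespace HasWirt

theorem congr (hf : HasWirt ξ f d d' ζ) (h : g =ᶠ[nhds ζ] f) : HasWirt ξ g d d' ζ :=
  ⟨h.differentiableAt_iff.2 hf.1, by rw [wirtDir_congr h, hf.2], by rw [wirtBarDir_congr h, hf.3]⟩

theorem of_eq (hf : HasWirt ξ f d d' ζ) (h : d = k) (h' : d' = k') : HasWirt ξ f k k' ζ := by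
  subst h h'; exact hf

theorem const (c : ℂ) : HasWirt ξ (fun _ => c) 0 0 ζ := by
  refine ⟨differentiableAt_const c, ?_, ?_⟩ <;> simp [wirtDir, wirtBarDir, wirt, wirtBar]

theorem add (hf : HasWirt ξ f d d' ζ) (hg : HasWirt ξ g k k' ζ) :
    HasWirt ξ (fun x => f x + g x) (d + k) (d' + k') ζ := by
  have h := fderiv_fun_add hf.1 hg.1
  refine ⟨hf.1.add hg.1, ?_, ?_⟩
  · rw [← hf.2, ← hg.2]
    simp only [wirtDir, wirt, h, add_apply, ← Finset.sum_add_distrib]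
    exact Finset.sum_congr rfl fun _ _ => by ring
  · rw [← hf.3, ← hg.3]
    simp only [wirtBarDir, wirtBar, h, add_apply, ← Finset.sum_add_distrib]
    exact Finset.sum_congr rfl fun _ _ => by ring

theorem mul (hf : HasWirt ξ f d d' ζ) (hg : HasWirt ξ g k k' ζ) :
    HasWirt ξ (fun x => f x * g x) (d * g ζ + f ζ * k) (d' * g ζ + f ζ * k') ζ := by
  have h := fderiv_fun_mul hf.1 hg.1
  refine ⟨hf.1.mul hg.1, ?_, ?_⟩
  · rw [← hf.2, ← hg.2]
    simp only [wirtDir, wirt, h, add_apply, smul_apply,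
      smul_eq_mul, Finset.sum_mul, Finset.mul_sum, ← Finset.sum_add_distrib]
    exact Finset.sum_congr rfl fun _ _ => by ring
  · rw [← hf.3, ← hg.3]
    simp only [wirtBarDir, wirtBar, h, add_apply,
      smul_apply,
      smul_eq_mul, Finset.sum_mul, Finset.mul_sum, ← Finset.sum_add_distrib]
    exact Finset.sum_congr rfl fun _ _ => by ring

theorem const_mul (c : ℂ) (hf : HasWirt ξ f d d' ζ) :
    HasWirt ξ (fun x => c * f x) (c * d) (c * d') ζ :=
  ((const c).mul hf).of_eq (by ring) (by ring)

theorem neg (hf : HasWirt ξ f d d' ζ) : HasWirt ξ (fun x => -f x) (-d) (-d') ζ := by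
  simpa using hf.const_mul (-1)

theorem sub (hf : HasWirt ξ f d d' ζ) (hg : HasWirt ξ g k k' ζ) :
    HasWirt ξ (fun x => f x - g x) (d - k) (d' - k') ζ := by
  simpa [sub_eq_add_neg] using hf.add hg.neg

theorem sum {κ : Type*} (s : Finset κ) {F : κ → (ι → ℂ) → ℂ} {D D' : κ → ℂ}
    (h : ∀ i ∈ s, HasWirt ξ (F i) (D i) (D' i) ζ) :
    HasWirt ξ (fun x => ∑ i ∈ s, F i x) (∑ i ∈ s, D i) (∑ i ∈ s, D' i) ζ := by
  classical
  induction s using Finset.induction_on with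
  | empty => simpa using const 0
  | insert i s hi ih =>
    simp only [Finset.sum_insert hi]
    exact (h i (by simp)).add (ih fun j hj => h j (by simp [hj]))

theorem conj (hf : HasWirt ξ f d d' ζ) :
    HasWirt ξ (fun x => star (f x)) (star d') (star d) ζ := by
  have h : HasFDerivAt (fun x => star (f x))
      ((Complex.conjCLE : ℂ →L[ℝ] ℂ).comp (fderiv ℝ f ζ)) ζ :=
    (Complex.conjCLE : ℂ →L[ℝ] ℂ).hasFDerivAt.comp ζ hf.1.hasFDerivAt
  refine ⟨h.differentiableAt, ?_, ?_⟩
  · rw [← hf.3]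
    simp only [wirtDir, wirt, wirtBarDir, wirtBar, h.fderiv, star_sum]
    refine Finset.sum_congr rfl fun _ _ => ?_
    simp
    left; ring
  · rw [← hf.2]
    simp only [wirtDir, wirt, wirtBarDir, wirtBar, h.fderiv, star_sum]
    refine Finset.sum_congr rfl fun _ _ => ?_
    simp

theorem real_comp {u : (ι → ℂ) → ℝ} (hf : HasWirt ξ (fun x => (u x : ℂ)) d d' ζ) {φ : ℝ → ℝ}
    {c : ℝ} (hφ : HasDerivAt φ c (u ζ)) :
    HasWirt ξ (fun x => (φ (u x) : ℂ)) (c * d) (c * d') ζ := by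
  have hu : DifferentiableAt ℝ u ζ := by
    have := Complex.reCLM.differentiableAt.comp ζ hf.1
    simpa [Function.comp_def] using this
  have h1 : HasFDerivAt (fun x => (u x : ℂ)) (Complex.ofRealCLM.comp (fderiv ℝ u ζ)) ζ :=
    Complex.ofRealCLM.hasFDerivAt.comp ζ hu.hasFDerivAt
  have h2 : HasFDerivAt (fun x => (φ (u x) : ℂ)) (Complex.ofRealCLM.comp (c • fderiv ℝ u ζ)) ζ :=
    Complex.ofRealCLM.hasFDerivAt.comp ζ (hφ.comp_hasFDerivAt ζ hu.hasFDerivAt)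
  refine ⟨h2.differentiableAt, ?_, ?_⟩
  · rw [← hf.2]
    simp only [wirtDir, wirt, h1.fderiv, h2.fderiv, Finset.mul_sum]
    refine Finset.sum_congr rfl fun _ _ => ?_
    simp; ring
  · rw [← hf.3]
    simp only [wirtBarDir, wirtBar, h1.fderiv, h2.fderiv, Finset.mul_sum]
    refine Finset.sum_congr rfl fun _ _ => ?_
    simp; ring

theorem inv (hf : HasWirt ξ f d d' ζ) (h0 : f ζ ≠ 0) :
    HasWirt ξ (fun x => (f x)⁻¹) (-d * (f ζ)⁻¹ ^ 2) (-d' * (f ζ)⁻¹ ^ 2) ζ := by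
  have h : HasFDerivAt (fun x => (f x)⁻¹) (-(f ζ ^ 2)⁻¹ • fderiv ℝ f ζ) ζ :=
    (hasDerivAt_inv h0).comp_hasFDerivAt_of_eq ζ hf.1.hasFDerivAt rfl
  refine ⟨h.differentiableAt, ?_, ?_⟩
  · rw [← hf.2]
    simp only [wirtDir, wirt, h.fderiv, neg_mul, Finset.sum_mul, ← Finset.sum_neg_distrib]
    refine Finset.sum_congr rfl fun _ _ => ?_
    simp; ring
  · rw [← hf.3]
    simp only [wirtBarDir, wirtBar, h.fderiv, neg_mul, Finset.sum_mul, ← Finset.sum_neg_distrib]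
    refine Finset.sum_congr rfl fun _ _ => ?_
    simp; ring

theorem coord (i : ι) : HasWirt ξ (fun x => x i) (ξ i) 0 ζ := by
  have h : HasFDerivAt (fun x : ι → ℂ => x i) (ContinuousLinearMap.proj (R := ℝ) i) ζ :=
    (ContinuousLinearMap.proj (R := ℝ) (φ := fun _ : ι => ℂ) i).hasFDerivAt
  have h1 (a : ι) (c : ℂ) : (Pi.single a c : ι → ℂ) i = if a = i then c else 0 := by
    rw [Pi.single_apply]; simp only [eq_comm]
  refine ⟨h.differentiableAt, ?_, ?_⟩
  · simp only [wirtDir, wirt, h.fderiv, ContinuousLinearMap.proj_apply, h1]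
    rw [Finset.sum_eq_single i]
    · simp
    · intro b _ hb; simp [hb]
    · simp
  · simp only [wirtBarDir, wirtBar, h.fderiv, ContinuousLinearMap.proj_apply, h1]
    rw [Finset.sum_eq_single i]
    · simp
    · intro b _ hb; simp [hb]
    · simp

end HasWirt

theorem hasWirt_of_differentiableAt (ξ : ι → ℂ) (hf : DifferentiableAt ℝ f ζ) :
    HasWirt ξ f (wirtDir ξ f ζ) (wirtBarDir ξ f ζ) ζ := ⟨hf, rfl, rfl⟩

theorem contDiffOn_wirt {Ω : Set (ι → ℂ)} (hΩ : IsOpen Ω) (hf : ContDiffOn ℝ ∞ f Ω) (a : ι) :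
    ContDiffOn ℝ ∞ (wirt a f) Ω := by
  have h : ContDiffOn ℝ ∞ (fderiv ℝ f) Ω := hf.fderiv_of_isOpen hΩ (by simp)
  exact ((h.clm_apply contDiffOn_const).sub
    (contDiffOn_const.mul (h.clm_apply contDiffOn_const))).div_const 2

theorem contDiffOn_wirtBar {Ω : Set (ι → ℂ)} (hΩ : IsOpen Ω) (hf : ContDiffOn ℝ ∞ f Ω) (a : ι) :
    ContDiffOn ℝ ∞ (wirtBar a f) Ω := by
  have h : ContDiffOn ℝ ∞ (fderiv ℝ f) Ω := hf.fderiv_of_isOpen hΩ (by simp)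
  exact ((h.clm_apply contDiffOn_const).add
    (contDiffOn_const.mul (h.clm_apply contDiffOn_const))).div_const 2

end Wirtinger

/-! ### Curvature of a Kähler metric in terms of its potential. -/

section Kahler

variable {ι : Type} [Fintype ι] [DecidableEq ι] {Ω : Set (ι → ℂ)} {ζ : ι → ℂ}

theorem differentiableAt_of_contDiffOn {ι : Type} [Fintype ι] {Ω : Set (ι → ℂ)} {ζ : ι → ℂ}
    {f : (ι → ℂ) → ℂ} (hΩ : IsOpen Ω)
    (hf : ContDiffOn ℝ ∞ f Ω) (hζ : ζ ∈ Ω) : DifferentiableAt ℝ f ζ :=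
  (hf.contDiffAt (hΩ.mem_nhds hζ)).differentiableAt (by simp)

theorem hasWirt_wirtBarDir {f : (ι → ℂ) → ℂ} (hΩ : IsOpen Ω) (hf : ContDiffOn ℝ ∞ f Ω)
    (hζ : ζ ∈ Ω) (ξ : ι → ℂ) :
    HasWirt ξ (wirtBarDir ξ f) (∑ d, star (ξ d) * wirtDir ξ (wirtBar d f) ζ)
      (∑ d, star (ξ d) * wirtBarDir ξ (wirtBar d f) ζ) ζ :=
  HasWirt.sum _ fun d _ => (hasWirt_of_differentiableAt ξ (differentiableAt_of_contDiffOn hΩ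
    (contDiffOn_wirtBar hΩ hf d) hζ)).const_mul _

theorem wirtDir_wirtBarDir {f : (ι → ℂ) → ℂ} (hΩ : IsOpen Ω) (hf : ContDiffOn ℝ ∞ f Ω)
    (hζ : ζ ∈ Ω) (ξ : ι → ℂ) :
    wirtDir ξ (wirtBarDir ξ f) ζ = ∑ a, ∑ b, wirt a (wirtBar b f) ζ * ξ a * star (ξ b) := by
  rw [(hasWirt_wirtBarDir hΩ hf hζ ξ).wirtDir_eq, Finset.sum_comm]
  simp only [wirtDir, Finset.mul_sum]
  exact Finset.sum_congr rfl fun _ _ => Finset.sum_congr rfl fun _ _ => by ring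

variable {φ : (ι → ℂ) → ℝ}

theorem contDiffOn_ofReal {ι : Type} [Fintype ι] {Ω : Set (ι → ℂ)} {φ : (ι → ℂ) → ℝ}
    (hφ : ContDiffOn ℝ ∞ φ Ω) :
    ContDiffOn ℝ ∞ (fun x => (φ x : ℂ)) Ω :=
  Complex.ofRealCLM.contDiff.comp_contDiffOn hφ

theorem contDiffOn_metric (hΩ : IsOpen Ω) (hφ : ContDiffOn ℝ ∞ φ Ω) (a b : ι) :
    ContDiffOn ℝ ∞ (fun x => metric φ x a b) Ω :=
  contDiffOn_wirt hΩ (contDiffOn_wirtBar hΩ (contDiffOn_ofReal hφ) b) a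

theorem sqLength_metric (hΩ : IsOpen Ω) (hφ : ContDiffOn ℝ ∞ φ Ω) (hζ : ζ ∈ Ω) (ξ : ι → ℂ) :
    sqLength (metric φ) ζ ξ = wirtDir ξ (wirtBarDir ξ fun x => (φ x : ℂ)) ζ := by
  rw [wirtDir_wirtBarDir hΩ (contDiffOn_ofReal hφ) hζ]; rfl

theorem sqLength_eq_dotProduct {ι : Type} [Fintype ι] (g : (ι → ℂ) → Matrix ι ι ℂ) (ζ ξ : ι → ℂ) :
    sqLength g ζ (star ξ) = star ξ ⬝ᵥ (g ζ).mulVec ξ := by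
  simp only [sqLength, dotProduct, Matrix.mulVec, Finset.mul_sum, Pi.star_apply, star_star]
  exact Finset.sum_congr rfl fun _ _ => Finset.sum_congr rfl fun _ _ => by ring

/-- A complex matrix whose quadratic form is positive is positive definite: it is automatically
Hermitian. -/
theorem posDef_of_sqLength_pos (g : (ι → ℂ) → Matrix ι ι ℂ) (ζ : ι → ℂ)
    (h : ∀ ξ, ξ ≠ 0 → 0 < sqLength g ζ ξ) : (g ζ).PosDef := by
  have h1 : ∀ x, x ≠ 0 → 0 < star x ⬝ᵥ (g ζ).mulVec x := fun x hx => by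
    rw [← sqLength_eq_dotProduct]; exact h _ (by simpa using hx)
  refine Matrix.PosDef.of_dotProduct_mulVec_pos ?_ fun x hx => h1 x hx
  -- Over `ℂ`, polarization makes an operator symmetric once `⟨Tv, v⟩` is always real; positivity in
  -- the order of `ℂ` includes being real.
  rw [← Matrix.isSymmetric_toEuclideanLin_iff, LinearMap.isSymmetric_iff_inner_map_self_real]
  intro v
  have h2 : inner ℂ ((Matrix.toEuclideanLin (g ζ)) v) v =
      star (star v.ofLp ⬝ᵥ (g ζ).mulVec v.ofLp) := by
    rw [← inner_conj_symm]
    simp [EuclideanSpace.inner_eq_star_dotProduct, dotProduct_comm]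
  rw [h2]
  by_cases hv : v.ofLp = 0
  · simp [hv]
  · have h3 := Complex.conj_eq_iff_im.2 (Complex.pos_iff.1 (h1 _ hv)).2.symm
    rw [← starRingEnd_apply, h3]; exact h3

/-- Since `ξ` does not vary with the base point, contraction with `ξ` commutes with differentiation.
This replaces index computations by two directional derivatives of a scalar function. -/
theorem wirtDir_wirtBarDir_sqLength (hΩ : IsOpen Ω) (hφ : ContDiffOn ℝ ∞ φ Ω) (hζ : ζ ∈ Ω) (ξ : ι → ℂ) :
    wirtDir ξ (wirtBarDir ξ fun x => sqLength (metric φ) x ξ) ζ =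
      ∑ a, ∑ b, ∑ c, ∑ d, wirt c (wirtBar d fun x => metric φ x a b) ζ *
        ξ a * star (ξ b) * ξ c * star (ξ d) := by
  have h1 : ∀ x ∈ Ω, wirtBarDir ξ (fun x => sqLength (metric φ) x ξ) x =
      ∑ a, ∑ b, (ξ a * star (ξ b)) * wirtBarDir ξ (fun x => metric φ x a b) x := by
    intro x hx
    refine HasWirt.wirtBarDir_eq (d := ∑ a, ∑ b,
      (ξ a * star (ξ b)) * wirtDir ξ (fun x => metric φ x a b) x) ?_
    refine (HasWirt.sum Finset.univ fun a _ => HasWirt.sum Finset.univ fun b _ =>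
      (hasWirt_of_differentiableAt ξ (differentiableAt_of_contDiffOn hΩ
        (contDiffOn_metric hΩ hφ a b) hx)).const_mul (ξ a * star (ξ b))).congr (.of_forall ?_)
    intro y
    exact Finset.sum_congr rfl fun _ _ => Finset.sum_congr rfl fun _ _ => by ring
  rw [wirtDir_congr (Filter.eventually_of_mem (hΩ.mem_nhds hζ) h1),
    (HasWirt.sum Finset.univ fun a _ => HasWirt.sum Finset.univ fun b _ =>
      (hasWirt_wirtBarDir hΩ (contDiffOn_metric hΩ hφ a b) hζ ξ).const_mul
        (ξ a * star (ξ b))).wirtDir_eq]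
  refine Finset.sum_congr rfl fun a _ => Finset.sum_congr rfl fun b _ => ?_
  rw [← (hasWirt_wirtBarDir hΩ (contDiffOn_metric hΩ hφ a b) hζ ξ).wirtDir_eq,
    wirtDir_wirtBarDir hΩ (contDiffOn_metric hΩ hφ a b) hζ]
  simp only [Finset.mul_sum]
  exact Finset.sum_congr rfl fun _ _ => Finset.sum_congr rfl fun _ _ => by ring

/-- Groups the contraction as a bilinear form in two vectors, so that positivity of the inverse
metric can be applied. -/
theorem sum_contract {ι : Type} [Fintype ι] (M : Matrix ι ι ℂ) (A B : ι → ι → ι → ℂ) (ξ : ι → ℂ) :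
    ∑ a, ∑ b, ∑ c, ∑ d, (∑ p, ∑ q, M p q * A c a p * B d q b) *
      ξ a * star (ξ b) * ξ c * star (ξ d) =
    (fun p => ∑ a, ξ a * ∑ c, ξ c * A c a p) ⬝ᵥ
      M.mulVec fun q => ∑ b, star (ξ b) * ∑ d, star (ξ d) * B d q b := by
  have h : ∀ F : ι → ι → ι → ι → ι → ι → ℂ, ∑ a, ∑ b, ∑ c, ∑ d, ∑ p, ∑ q, F a b c d p q =
      ∑ p, ∑ q, ∑ b, ∑ d, ∑ a, ∑ c, F a b c d p q := by
    intro F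
    simp only [← Fintype.sum_prod_type']
    exact Fintype.sum_equiv
      ⟨fun x => (x.2.2.2.2.1, x.2.2.2.2.2, x.2.1, x.2.2.2.1, x.1, x.2.2.1),
        fun x => (x.2.2.2.2.1, x.2.2.1, x.2.2.2.2.2, x.2.2.2.1, x.1, x.2.1),
        fun _ => rfl, fun _ => rfl⟩ _ _ fun _ => rfl
  simp only [dotProduct, Matrix.mulVec, Finset.mul_sum, Finset.sum_mul]
  rw [h]
  refine Finset.sum_congr rfl fun _ _ => Finset.sum_congr rfl fun _ _ =>
    Finset.sum_congr rfl fun _ _ => Finset.sum_congr rfl fun _ _ =>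
    Finset.sum_congr rfl fun _ _ => Finset.sum_congr rfl fun _ _ => by ring

/-- The part of the curvature that is quadratic in the first derivatives of the metric. -/
theorem curvature_quadratic_part_nonneg (hΩ : IsOpen Ω) (hφ : IsKahlerPotentialOn φ Ω) (hζ : ζ ∈ Ω)
    (ξ : ι → ℂ) :
    0 ≤ ∑ a, ∑ b, ∑ c, ∑ d, (∑ p, ∑ q, (metric φ ζ)⁻¹ p q *
      wirt c (fun x => metric φ x a p) ζ * wirtBar d (fun x => metric φ x q b) ζ) *
        ξ a * star (ξ b) * ξ c * star (ξ d) := by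
  set V : ι → ℂ := fun p => ∑ a, ξ a * wirtDir ξ (fun x => metric φ x a p) ζ with hV
  have hW : ∀ q, star (V q) = ∑ b, star (ξ b) * wirtBarDir ξ (fun x => metric φ x q b) ζ := by
    intro q
    simp only [hV, star_sum, star_mul']
    refine Finset.sum_congr rfl fun b _ => ?_
    rw [← (hasWirt_of_differentiableAt ξ (differentiableAt_of_contDiffOn hΩ
      (contDiffOn_metric hΩ hφ.1 b q) hζ)).conj.wirtBarDir_eq]
    congr 1
    -- Hermitian symmetry holds on all of the open set `Ω`, so it can be differentiated.
    refine wirtBarDir_congr (Filter.eventually_of_mem (hΩ.mem_nhds hζ) fun x hx => ?_)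
    exact (hφ.2 x hx).isHermitian.apply q b
  have h := (hφ.2 ζ hζ).inv.posSemidef.dotProduct_mulVec_nonneg (star V)
  rw [star_star, show star V = _ from funext hW] at h
  exact h.trans_eq (sum_contract (metric φ ζ)⁻¹ (fun c a p => wirt c (fun x => metric φ x a p) ζ)
    (fun d q b => wirtBar d (fun x => metric φ x q b) ζ) ξ).symm

theorem sum_curvature (hΩ : IsOpen Ω) (hφ : ContDiffOn ℝ ∞ φ Ω) (hζ : ζ ∈ Ω) (ξ : ι → ℂ) :
    ∑ a, ∑ b, ∑ c, ∑ d, curvature (metric φ) ζ a b c d * ξ a * star (ξ b) * ξ c * star (ξ d) =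
      -wirtDir ξ (wirtBarDir ξ fun x => sqLength (metric φ) x ξ) ζ +
      ∑ a, ∑ b, ∑ c, ∑ d, (∑ p, ∑ q, (metric φ ζ)⁻¹ p q *
        wirt c (fun x => metric φ x a p) ζ * wirtBar d (fun x => metric φ x q b) ζ) *
          ξ a * star (ξ b) * ξ c * star (ξ d) := by
  rw [wirtDir_wirtBarDir_sqLength hΩ hφ hζ]
  simp only [curvature, add_mul, neg_mul, Finset.sum_add_distrib, Finset.sum_neg_distrib]

/-- The holomorphic sectional curvature is bounded below as soon as the fourth derivatives of the
potential along complex lines are bounded by the square of the metric. -/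
theorem le_holSectCurvature (hΩ : IsOpen Ω) (hφ : IsKahlerPotentialOn φ Ω) (hζ : ζ ∈ Ω)
    {ξ : ι → ℂ} {G C : ℝ} (hG : 0 < G) (hs : sqLength (metric φ) ζ ξ = G)
    (hC : ‖wirtDir ξ (wirtBarDir ξ fun x => sqLength (metric φ) x ξ) ζ‖ ≤ C * G ^ 2) :
    -(2 * C) ≤ holSectCurvature (metric φ) ζ ξ := by
  have h0 := (Complex.nonneg_iff.1 (curvature_quadratic_part_nonneg hΩ hφ hζ ξ)).1
  have h1 := (Complex.re_le_norm _).trans hC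
  rw [holSectCurvature, hs, sum_curvature hΩ hφ.1 hζ, ← Complex.ofReal_pow, Complex.div_ofReal_re,
    le_div_iff₀ (by positivity)]
  simp only [Complex.mul_re, Complex.add_re, Complex.neg_re, Complex.re_ofNat, Complex.im_ofNat,
    zero_mul, sub_zero]
  linarith

end Kahler

/-! ### Invariants of Yin's metric and their first derivatives. -/

section Yin

variable {m n : ℕ} {p : ℝ}

/-- The Hermitian product of the `ℂ^n`-components. -/
def innerZ (x y : Fin n ⊕ Fin m → ℂ) : ℂ := ∑ i, x (.inl i) * star (y (.inl i))

/-- The Hermitian product of the `ℂ^m`-components. -/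
def innerW (x y : Fin n ⊕ Fin m → ℂ) : ℂ := ∑ j, x (.inr j) * star (y (.inr j))

/-- The complex-valued function `(1 - |z|²)^{-1/p}`. -/
def zPow (p : ℝ) (ζ : Fin n ⊕ Fin m → ℂ) : ℂ := ((1 - normZ ζ ^ 2) ^ (-1 / p) : ℝ)

/-- The derivative of `-log (1 - |z|²)` in the direction `ξ`. -/
def beta (ξ ζ : Fin n ⊕ Fin m → ℂ) : ℂ := innerZ ξ ζ * (1 - innerZ ζ ζ)⁻¹

/-- The complex Hessian of `-log (1 - |z|²)` in the direction `ξ`. -/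
def hessU (ξ ζ : Fin n ⊕ Fin m → ℂ) : ℂ :=
  innerZ ξ ξ * (1 - innerZ ζ ζ)⁻¹ + beta ξ ζ * star (beta ξ ζ)

/-- The function `X / (1 - X)`. -/
def kap (p : ℝ) (ζ : Fin n ⊕ Fin m → ℂ) : ℂ := yinX p ζ * (1 - (yinX p ζ : ℂ))⁻¹

/-- The derivative of `-log (1 - X)` in the direction `ξ`. -/
def gamma (p : ℝ) (ξ ζ : Fin n ⊕ Fin m → ℂ) : ℂ :=
  zPow p ζ * (innerW ξ ζ + (p : ℂ)⁻¹ * beta ξ ζ * innerW ζ ζ) * (1 - (yinX p ζ : ℂ))⁻¹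

/-- The squared length `(1 - |z|²)^{-1/p} |η + p⁻¹ β w|² / (1 - X)`, where `η` is the
`ℂ^m`-component of `ξ`. -/
def vert (p : ℝ) (ξ ζ : Fin n ⊕ Fin m → ℂ) : ℂ :=
  zPow p ζ * (innerW ξ ξ + (p : ℂ)⁻¹ * star (beta ξ ζ) * innerW ξ ζ +
    (p : ℂ)⁻¹ * beta ξ ζ * star (innerW ξ ζ) +
    (p : ℂ)⁻¹ * (p : ℂ)⁻¹ * beta ξ ζ * star (beta ξ ζ) * innerW ζ ζ) * (1 - (yinX p ζ : ℂ))⁻¹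

theorem star_innerZ (x y : Fin n ⊕ Fin m → ℂ) : star (innerZ x y) = innerZ y x := by
  simp [innerZ, mul_comm]

theorem star_innerW (x y : Fin n ⊕ Fin m → ℂ) : star (innerW x y) = innerW y x := by
  simp [innerW, mul_comm]

theorem ofReal_normZ_sq (ζ : Fin n ⊕ Fin m → ℂ) : ((normZ ζ ^ 2 : ℝ) : ℂ) = innerZ ζ ζ := by
  rw [normZ, EuclideanSpace.norm_sq_eq, innerZ]
  push_cast
  exact Finset.sum_congr rfl fun i _ => (Complex.mul_conj' _).symm

theorem ofReal_normW_sq (ζ : Fin n ⊕ Fin m → ℂ) : ((normW ζ ^ 2 : ℝ) : ℂ) = innerW ζ ζ := by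
  rw [normW, EuclideanSpace.norm_sq_eq, innerW]
  push_cast
  exact Finset.sum_congr rfl fun i _ => (Complex.mul_conj' _).symm

theorem ofReal_yinX (ζ : Fin n ⊕ Fin m → ℂ) :
    (yinX p ζ : ℂ) = innerW ζ ζ * zPow p ζ := by
  rw [yinX, Complex.ofReal_mul, ofReal_normW_sq, zPow]

theorem star_zPow (ζ : Fin n ⊕ Fin m → ℂ) : star (zPow p ζ) = zPow p ζ :=
  Complex.conj_ofReal _

theorem star_ofReal_inv (p : ℝ) : star (p : ℂ)⁻¹ = (p : ℂ)⁻¹ := by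
  simp

theorem star_yinX (ζ : Fin n ⊕ Fin m → ℂ) :
    star (1 - (yinX p ζ : ℂ))⁻¹ = (1 - (yinX p ζ : ℂ))⁻¹ := by
  simp

theorem star_one_sub_innerZ (ζ : Fin n ⊕ Fin m → ℂ) :
    star (1 - innerZ ζ ζ)⁻¹ = (1 - innerZ ζ ζ)⁻¹ := by
  rw [← ofReal_normZ_sq]; simp

/-- The domain `|z| < 1`, `X < 1`, which is another description of the ellipsoid. -/
def yinDomain (m n : ℕ) (p : ℝ) : Set (Fin n ⊕ Fin m → ℂ) :=
  {ζ | normZ ζ ^ 2 < 1 ∧ yinX p ζ < 1}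

variable {ξ ζ : Fin n ⊕ Fin m → ℂ}

theorem hasWirt_innerZ_self : HasWirt ξ (fun x => innerZ x x) (innerZ ξ ζ) (innerZ ζ ξ) ζ := by
  refine (HasWirt.sum Finset.univ fun i _ =>
    (HasWirt.coord (Sum.inl i)).mul (HasWirt.coord (Sum.inl i)).conj).of_eq ?_ ?_ <;> simp [innerZ]

theorem hasWirt_innerW_self : HasWirt ξ (fun x => innerW x x) (innerW ξ ζ) (innerW ζ ξ) ζ := by
  refine (HasWirt.sum Finset.univ fun i _ =>
    (HasWirt.coord (Sum.inr i)).mul (HasWirt.coord (Sum.inr i)).conj).of_eq ?_ ?_ <;> simp [innerW]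

theorem hasWirt_innerZ : HasWirt ξ (fun x => innerZ ξ x) 0 (innerZ ξ ξ) ζ := by
  refine (HasWirt.sum Finset.univ fun i _ =>
    (HasWirt.coord (Sum.inl i)).conj.const_mul (ξ (Sum.inl i))).of_eq ?_ ?_ <;> simp [innerZ]

theorem hasWirt_innerW : HasWirt ξ (fun x => innerW ξ x) 0 (innerW ξ ξ) ζ := by
  refine (HasWirt.sum Finset.univ fun i _ =>
    (HasWirt.coord (Sum.inr i)).conj.const_mul (ξ (Sum.inr i))).of_eq ?_ ?_ <;> simp [innerW]

theorem one_sub_innerZ_ne_zero (hζ : ζ ∈ yinDomain m n p) : 1 - innerZ ζ ζ ≠ 0 := by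
  rw [← ofReal_normZ_sq, ← Complex.ofReal_one, ← Complex.ofReal_sub, Complex.ofReal_ne_zero]
  exact (sub_pos.2 hζ.1).ne'

theorem one_sub_yinX_ne_zero (hζ : ζ ∈ yinDomain m n p) : 1 - (yinX p ζ : ℂ) ≠ 0 := by
  rw [← Complex.ofReal_one, ← Complex.ofReal_sub, Complex.ofReal_ne_zero]
  exact (sub_pos.2 hζ.2).ne'

theorem star_beta : star (beta ξ ζ) = innerZ ζ ξ * (1 - innerZ ζ ζ)⁻¹ := by
  rw [beta, star_mul', star_one_sub_innerZ, star_innerZ]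

theorem hasWirt_one_sub_innerZ_inv (hζ : ζ ∈ yinDomain m n p) :
    HasWirt ξ (fun x => (1 - innerZ x x)⁻¹) (beta ξ ζ * (1 - innerZ ζ ζ)⁻¹)
      (star (beta ξ ζ) * (1 - innerZ ζ ζ)⁻¹) ζ := by
  refine (((HasWirt.const 1).sub hasWirt_innerZ_self).inv (one_sub_innerZ_ne_zero hζ)).of_eq ?_ ?_
  · rw [beta]; ring
  · rw [star_beta]; ring

/-- `innerZ ξ x` is antiholomorphic in `x`, so the `(1, 0)`-derivative only hits `(1 - |z|²)⁻¹` and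
reproduces `beta`. -/
theorem hasWirt_beta (hζ : ζ ∈ yinDomain m n p) :
    HasWirt ξ (beta ξ) (beta ξ ζ ^ 2) (hessU ξ ζ) ζ := by
  refine (hasWirt_innerZ.mul (hasWirt_one_sub_innerZ_inv hζ)).of_eq ?_ ?_
  · rw [beta]; ring
  · rw [hessU]; rw [show beta ξ ζ = innerZ ξ ζ * (1 - innerZ ζ ζ)⁻¹ from rfl]; ring

theorem star_hessU : star (hessU ξ ζ) = hessU ξ ζ := by
  rw [hessU, star_add, star_mul', star_mul', star_one_sub_innerZ, star_innerZ, star_star]; ring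

theorem hasWirt_star_beta (hζ : ζ ∈ yinDomain m n p) :
    HasWirt ξ (fun x => star (beta ξ x)) (hessU ξ ζ) (star (beta ξ ζ) ^ 2) ζ :=
  (hasWirt_beta hζ).conj.of_eq star_hessU (star_pow _ _)

theorem hasWirt_hessU (hζ : ζ ∈ yinDomain m n p) :
    HasWirt ξ (hessU ξ) (2 * (beta ξ ζ * hessU ξ ζ)) (2 * (star (beta ξ ζ) * hessU ξ ζ)) ζ := by
  refine (((hasWirt_one_sub_innerZ_inv hζ).const_mul (innerZ ξ ξ)).add
    ((hasWirt_beta hζ).mul (hasWirt_star_beta hζ))).of_eq ?_ ?_ <;>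
  · rw [hessU]; ring

/-- `zPow` is the exponential of `-p⁻¹ log (1 - |z|²)`, so its logarithmic derivative is `p⁻¹ β`. -/
theorem hasWirt_zPow (hζ : ζ ∈ yinDomain m n p) :
    HasWirt ξ (zPow p) ((p : ℂ)⁻¹ * beta ξ ζ * zPow p ζ)
      ((p : ℂ)⁻¹ * star (beta ξ ζ) * zPow p ζ) ζ := by
  have h0 : 0 < 1 - normZ ζ ^ 2 := sub_pos.2 hζ.1
  have h1 : HasWirt ξ (fun x => ((1 - normZ x ^ 2 : ℝ) : ℂ)) (0 - innerZ ξ ζ)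
      (0 - innerZ ζ ξ) ζ := by
    refine ((HasWirt.const 1).sub hasWirt_innerZ_self).congr (.of_forall fun x => ?_)
    simp only [Complex.ofReal_sub, Complex.ofReal_one, ofReal_normZ_sq]
  have h2 := h1.real_comp (Real.hasDerivAt_rpow_const (p := -1 / p) (Or.inl h0.ne'))
  have h3 : ((-1 / p * (1 - normZ ζ ^ 2) ^ (-1 / p - 1) : ℝ) : ℂ) =
      -(p : ℂ)⁻¹ * zPow p ζ * (1 - innerZ ζ ζ)⁻¹ := by
    rw [Real.rpow_sub_one h0.ne', zPow, ← ofReal_normZ_sq]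
    push_cast; ring
  rw [h3] at h2
  refine h2.of_eq ?_ ?_
  · rw [beta]; ring
  · rw [star_beta]; ring

theorem star_gamma : star (gamma p ξ ζ) = zPow p ζ * (star (innerW ξ ζ) +
    (p : ℂ)⁻¹ * star (beta ξ ζ) * innerW ζ ζ) * (1 - (yinX p ζ : ℂ))⁻¹ := by
  simp only [gamma, star_mul', star_add, star_zPow, star_yinX, star_ofReal_inv, star_innerW]

theorem hasWirt_yinX (hζ : ζ ∈ yinDomain m n p) :
    HasWirt ξ (fun x => (yinX p x : ℂ)) (gamma p ξ ζ * (1 - (yinX p ζ : ℂ)))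
      (star (gamma p ξ ζ) * (1 - (yinX p ζ : ℂ))) ζ := by
  have h := one_sub_yinX_ne_zero hζ
  refine ((hasWirt_innerW_self.mul (hasWirt_zPow hζ)).congr
    (.of_forall fun x => ofReal_yinX x)).of_eq ?_ ?_
  · rw [gamma, inv_mul_cancel_right₀ h]; ring
  · rw [star_gamma, inv_mul_cancel_right₀ h, star_innerW]; ring

theorem hasWirt_one_sub_yinX_inv (hζ : ζ ∈ yinDomain m n p) :
    HasWirt ξ (fun x => (1 - (yinX p x : ℂ))⁻¹) (gamma p ξ ζ * (1 - (yinX p ζ : ℂ))⁻¹)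
      (star (gamma p ξ ζ) * (1 - (yinX p ζ : ℂ))⁻¹) ζ := by
  have h := one_sub_yinX_ne_zero hζ
  refine (((HasWirt.const 1).sub (hasWirt_yinX hζ)).inv h).of_eq ?_ ?_ <;>
  · field_simp; ring

/-- `kap` need not stay bounded as `X → 1`, so it cannot serve as a weight-zero coefficient; it is
only used inside products that the metric controls. -/
theorem hasWirt_kap (hζ : ζ ∈ yinDomain m n p) :
    HasWirt ξ (kap p) (gamma p ξ ζ + kap p ζ * gamma p ξ ζ)
      (star (gamma p ξ ζ) + kap p ζ * star (gamma p ξ ζ)) ζ := by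
  have h := one_sub_yinX_ne_zero hζ
  refine ((hasWirt_yinX hζ).mul (hasWirt_one_sub_yinX_inv hζ)).of_eq ?_ ?_ <;>
  · rw [kap]; field_simp

/-- The `(0, 1)`-part is the complex Hessian of `-log (1 - X)`. Here `kap` appears only next to
`beta ^ 2` or `hessU`, which is where these two products enter the list of generators. -/
theorem hasWirt_gamma (hζ : ζ ∈ yinDomain m n p) :
    HasWirt ξ (gamma p ξ) (2 * (p : ℂ)⁻¹ * (beta ξ ζ * gamma p ξ ζ) +
        (p : ℂ)⁻¹ * (1 - (p : ℂ)⁻¹) * (kap p ζ * beta ξ ζ ^ 2) + gamma p ξ ζ ^ 2)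
      (vert p ξ ζ + (p : ℂ)⁻¹ * (kap p ζ * hessU ξ ζ) + gamma p ξ ζ * star (gamma p ξ ζ)) ζ := by
  refine (((hasWirt_zPow hζ).mul (hasWirt_innerW.add
    (((hasWirt_beta hζ).const_mul (p : ℂ)⁻¹).mul hasWirt_innerW_self))).mul
    (hasWirt_one_sub_yinX_inv hζ)).of_eq ?_ ?_
  · simp only [gamma, kap, ofReal_yinX]; ring
  · rw [star_gamma]
    simp only [gamma, kap, vert, ofReal_yinX, ← star_innerW ξ ζ]; ring

/-- No further invariant appears, so the list of generators is complete. -/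
theorem hasWirt_vert (hζ : ζ ∈ yinDomain m n p) :
    HasWirt ξ (vert p ξ) (2 * (p : ℂ)⁻¹ * (beta ξ ζ * vert p ξ ζ) +
        (p : ℂ)⁻¹ * (hessU ξ ζ * gamma p ξ ζ) +
        (p : ℂ)⁻¹ * (1 - (p : ℂ)⁻¹) * (beta ξ ζ ^ 2 * star (gamma p ξ ζ)) +
        vert p ξ ζ * gamma p ξ ζ)
      (2 * (p : ℂ)⁻¹ * (star (beta ξ ζ) * vert p ξ ζ) +
        (p : ℂ)⁻¹ * (hessU ξ ζ * star (gamma p ξ ζ)) +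
        (p : ℂ)⁻¹ * (1 - (p : ℂ)⁻¹) * (star (beta ξ ζ) ^ 2 * gamma p ξ ζ) +
        vert p ξ ζ * star (gamma p ξ ζ)) ζ := by
  have hb := hasWirt_beta (ξ := ξ) hζ
  have hb' := hasWirt_star_beta (ξ := ξ) hζ
  refine (((hasWirt_zPow hζ).mul ((((HasWirt.const (innerW ξ ξ)).add
    ((hb'.const_mul (p : ℂ)⁻¹).mul hasWirt_innerW)).add
    ((hb.const_mul (p : ℂ)⁻¹).mul hasWirt_innerW.conj)).add
    (((hb.const_mul ((p : ℂ)⁻¹ * (p : ℂ)⁻¹)).mul hb').mul hasWirt_innerW_self))).mul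
    (hasWirt_one_sub_yinX_inv hζ)).of_eq ?_ ?_ <;>
  · rw [star_gamma]
    simp only [gamma, vert, ← star_innerW ξ ζ, star_innerW ξ ξ, star_zero]; ring

end Yin

/-! ### Weighted polynomials: closure under differentiation and size estimates. -/

section Graded

variable {m n : ℕ} {p : ℝ}

/-- The weighted homogeneous polynomials in the invariants of a tangent vector and their
conjugates, where `beta` and `gamma` have weight one, and `hessU`, `vert`, `kap * hessU` and
`kap * beta ^ 2` have weight two. -/
inductive YinPoly (m n : ℕ) (p : ℝ) :
    ℕ → ((Fin n ⊕ Fin m → ℂ) → (Fin n ⊕ Fin m → ℂ) → ℂ) → Prop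
  | beta : YinPoly m n p 1 fun ξ ζ => Ellipsoid.beta ξ ζ
  | gamma : YinPoly m n p 1 fun ξ ζ => Ellipsoid.gamma p ξ ζ
  | hessU : YinPoly m n p 2 fun ξ ζ => Ellipsoid.hessU ξ ζ
  | vert : YinPoly m n p 2 fun ξ ζ => Ellipsoid.vert p ξ ζ
  | kap_mul_hessU : YinPoly m n p 2 fun ξ ζ => kap p ζ * Ellipsoid.hessU ξ ζ
  | kap_mul_beta_sq : YinPoly m n p 2 fun ξ ζ => kap p ζ * Ellipsoid.beta ξ ζ ^ 2
  | conj {k F} : YinPoly m n p k F → YinPoly m n p k fun ξ ζ => star (F ξ ζ)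
  | const_mul {k F} (c : ℂ) : YinPoly m n p k F → YinPoly m n p k fun ξ ζ => c * F ξ ζ
  | add {k F G} : YinPoly m n p k F → YinPoly m n p k G → YinPoly m n p k fun ξ ζ => F ξ ζ + G ξ ζ
  | mul {j k l F G} : YinPoly m n p j F → YinPoly m n p k G → j + k = l →
      YinPoly m n p l fun ξ ζ => F ξ ζ * G ξ ζ

theorem YinPoly.sq {k l : ℕ} {F : (Fin n ⊕ Fin m → ℂ) → (Fin n ⊕ Fin m → ℂ) → ℂ}
    (h : YinPoly m n p k F) (hl : k + k = l) : YinPoly m n p l fun ξ ζ => F ξ ζ ^ 2 := by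
  simpa only [pow_two] using h.mul h hl

/-- By the Leibniz rule only the generators need checking. `D` and `D'` are chosen before `ξ` and
`ζ`, which makes the later bounds uniform. -/
theorem YinPoly.exists_hasWirt {k : ℕ} {F : (Fin n ⊕ Fin m → ℂ) → (Fin n ⊕ Fin m → ℂ) → ℂ}
    (hF : YinPoly m n p k F) : ∃ D D', YinPoly m n p (k + 1) D ∧ YinPoly m n p (k + 1) D' ∧
      ∀ ξ, ∀ ζ ∈ yinDomain m n p, HasWirt ξ (F ξ) (D ξ ζ) (D' ξ ζ) ζ := by
  induction hF with
  | beta => exact ⟨_, _, beta.sq rfl, hessU, fun ξ ζ hζ => hasWirt_beta hζ⟩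
  | gamma =>
    exact ⟨_, _, (((beta.mul gamma rfl).const_mul _).add (kap_mul_beta_sq.const_mul _)).add
      (gamma.sq rfl), (vert.add (kap_mul_hessU.const_mul _)).add (gamma.mul gamma.conj rfl),
      fun ξ ζ hζ => hasWirt_gamma hζ⟩
  | hessU =>
    exact ⟨_, _, (beta.mul hessU rfl).const_mul _, (beta.conj.mul hessU rfl).const_mul _,
      fun ξ ζ hζ => hasWirt_hessU hζ⟩
  | vert =>
    exact ⟨_, _, ((((beta.mul vert rfl).const_mul _).add ((hessU.mul gamma rfl).const_mul _)).add
      (((beta.sq rfl).mul gamma.conj rfl).const_mul _)).add (vert.mul gamma rfl),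
      ((((beta.conj.mul vert rfl).const_mul _).add ((hessU.mul gamma.conj rfl).const_mul _)).add
      (((beta.conj.sq rfl).mul gamma rfl).const_mul _)).add (vert.mul gamma.conj rfl),
      fun ξ ζ hζ => hasWirt_vert hζ⟩
  | kap_mul_hessU =>
    refine ⟨_, _, ((gamma.mul hessU rfl).add (kap_mul_hessU.mul gamma rfl)).add
      ((beta.mul kap_mul_hessU rfl).const_mul 2), ((gamma.conj.mul hessU rfl).add
      (kap_mul_hessU.mul gamma.conj rfl)).add ((beta.conj.mul kap_mul_hessU rfl).const_mul 2),
      fun ξ ζ hζ => ((hasWirt_kap hζ).mul (hasWirt_hessU hζ)).of_eq ?_ ?_⟩ <;> ring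
  | kap_mul_beta_sq =>
    refine ⟨_, _, ((gamma.mul (beta.sq rfl) rfl).add (kap_mul_beta_sq.mul gamma rfl)).add
      -- As `∂̄_ξ β` is `hessU`, the `(0, 1)`-part contains `2 β (κ hessU)`, whereas the `(1,
      -- 0)`-part contains `2 β (κ β²)`.
      ((beta.mul kap_mul_beta_sq rfl).const_mul 2), ((gamma.conj.mul (beta.sq rfl) rfl).add
      (kap_mul_beta_sq.mul gamma.conj rfl)).add ((beta.mul kap_mul_hessU rfl).const_mul 2),
      fun ξ ζ hζ => (((hasWirt_kap hζ).mul ((hasWirt_beta hζ).mul (hasWirt_beta hζ))).congr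
        (.of_forall fun x => ?_)).of_eq ?_ ?_⟩
    · simp only [pow_two]
    all_goals ring
  | conj _ ih =>
    obtain ⟨D, D', hD, hD', h⟩ := ih
    exact ⟨_, _, hD'.conj, hD.conj, fun ξ ζ hζ => (h ξ ζ hζ).conj⟩
  | const_mul c _ ih =>
    obtain ⟨D, D', hD, hD', h⟩ := ih
    exact ⟨_, _, hD.const_mul c, hD'.const_mul c, fun ξ ζ hζ => (h ξ ζ hζ).const_mul c⟩
  | add _ _ ih₁ ih₂ =>
    obtain ⟨D, D', hD, hD', h⟩ := ih₁
    obtain ⟨E, E', hE, hE', h'⟩ := ih₂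
    exact ⟨_, _, hD.add hE, hD'.add hE', fun ξ ζ hζ => (h ξ ζ hζ).add (h' ξ ζ hζ)⟩
  | mul hF hG hl ih₁ ih₂ =>
    obtain ⟨D, D', hD, hD', h⟩ := ih₁
    obtain ⟨E, E', hE, hE', h'⟩ := ih₂
    exact ⟨_, _, (hD.mul hG (by omega)).add (hF.mul hE (by omega)),
      (hD'.mul hG (by omega)).add (hF.mul hE' (by omega)),
      fun ξ ζ hζ => (h ξ ζ hζ).mul (h' ξ ζ hζ)⟩

/-- A norm of tangent vectors, equivalent to that of the metric. -/
def yinSize (p : ℝ) (ξ ζ : Fin n ⊕ Fin m → ℂ) : ℝ :=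
  ‖hessU ξ ζ‖ + ‖vert p ξ ζ‖ + ‖kap p ζ * hessU ξ ζ‖ + ‖gamma p ξ ζ‖ ^ 2

variable {ξ ζ : Fin n ⊕ Fin m → ℂ}

theorem innerZ_self_nonneg : 0 ≤ innerZ ξ ξ := Finset.sum_nonneg fun _ _ => mul_star_self_nonneg _

theorem innerW_self_nonneg : 0 ≤ innerW ξ ξ := Finset.sum_nonneg fun _ _ => mul_star_self_nonneg _

theorem one_sub_innerZ_inv_pos (hζ : ζ ∈ yinDomain m n p) : 0 < (1 - innerZ ζ ζ)⁻¹ := by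
  rw [← ofReal_normZ_sq, ← Complex.ofReal_one, ← Complex.ofReal_sub, ← Complex.ofReal_inv,
    Complex.zero_lt_real]
  exact inv_pos.2 (sub_pos.2 hζ.1)

theorem one_sub_yinX_inv_pos (hζ : ζ ∈ yinDomain m n p) : 0 < (1 - (yinX p ζ : ℂ))⁻¹ := by
  rw [← Complex.ofReal_one, ← Complex.ofReal_sub, ← Complex.ofReal_inv, Complex.zero_lt_real]
  exact inv_pos.2 (sub_pos.2 hζ.2)

theorem zPow_pos (hζ : ζ ∈ yinDomain m n p) : 0 < zPow p ζ :=
  Complex.zero_lt_real.2 (Real.rpow_pos_of_pos (sub_pos.2 hζ.1) _)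

theorem kap_nonneg (hζ : ζ ∈ yinDomain m n p) : 0 ≤ kap p ζ := by
  refine mul_nonneg ?_ (one_sub_yinX_inv_pos hζ).le
  rw [ofReal_yinX]
  exact mul_nonneg innerW_self_nonneg (zPow_pos hζ).le

theorem hessU_nonneg (hζ : ζ ∈ yinDomain m n p) : 0 ≤ hessU ξ ζ :=
  add_nonneg (mul_nonneg innerZ_self_nonneg (one_sub_innerZ_inv_pos hζ).le) (mul_star_self_nonneg _)

theorem vert_nonneg (hζ : ζ ∈ yinDomain m n p) : 0 ≤ vert p ξ ζ := by
  refine mul_nonneg (mul_nonneg (zPow_pos hζ).le ?_) (one_sub_yinX_inv_pos hζ).le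
  have h : 0 ≤ ∑ j, (ξ (Sum.inr j) + (p : ℂ)⁻¹ * beta ξ ζ * ζ (Sum.inr j)) *
      star (ξ (Sum.inr j) + (p : ℂ)⁻¹ * beta ξ ζ * ζ (Sum.inr j)) :=
    Finset.sum_nonneg fun _ _ => mul_star_self_nonneg _
  refine h.trans_eq ?_
  rw [star_innerW]
  simp only [innerW, Finset.mul_sum, ← Finset.sum_add_distrib]
  refine Finset.sum_congr rfl fun j _ => ?_
  rw [star_add, star_mul', star_mul', star_ofReal_inv]
  ring

/-- `hessU` is `|β|²` plus a nonnegative term. This also controls `kap * beta ^ 2` by `kap * hessU`.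
-/
theorem norm_beta_sq_le (hζ : ζ ∈ yinDomain m n p) : ‖beta ξ ζ‖ ^ 2 ≤ ‖hessU ξ ζ‖ := by
  have h : beta ξ ζ * star (beta ξ ζ) ≤ hessU ξ ζ :=
    le_add_of_nonneg_left (mul_nonneg innerZ_self_nonneg (one_sub_innerZ_inv_pos hζ).le)
  rw [Complex.eq_coe_norm_of_nonneg (mul_star_self_nonneg (beta ξ ζ)),
    Complex.eq_coe_norm_of_nonneg (hessU_nonneg hζ), Complex.real_le_real, norm_mul,
    norm_star, ← pow_two] at h
  exact h

theorem yinSize_nonneg : 0 ≤ yinSize p ξ ζ := by unfold yinSize; positivity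

/-- `yinSize` is quadratic in `ξ`, so its square root has weight one. The generators satisfy the
bound with constant `1`, and the bound passes to sums and products. -/
theorem YinPoly.exists_bound {k : ℕ} {F : (Fin n ⊕ Fin m → ℂ) → (Fin n ⊕ Fin m → ℂ) → ℂ}
    (hF : YinPoly m n p k F) : ∃ C : ℝ, 0 ≤ C ∧
      ∀ ξ, ∀ ζ ∈ yinDomain m n p, ‖F ξ ζ‖ ≤ C * √(yinSize p ξ ζ) ^ k := by
  induction hF with
  | beta =>
    refine ⟨1, zero_le_one, fun ξ ζ hζ => ?_⟩
    rw [one_mul, pow_one]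
    refine Real.le_sqrt_of_sq_le ((norm_beta_sq_le hζ).trans ?_)
    simp only [yinSize, add_assoc]
    exact le_add_of_nonneg_right (by positivity)
  | gamma =>
    refine ⟨1, zero_le_one, fun ξ ζ hζ => ?_⟩
    rw [one_mul, pow_one]
    refine Real.le_sqrt_of_sq_le ?_
    exact le_add_of_nonneg_left (by positivity)
  | hessU =>
    refine ⟨1, zero_le_one, fun ξ ζ hζ => ?_⟩
    rw [one_mul, Real.sq_sqrt yinSize_nonneg]
    simp only [yinSize, add_assoc]
    exact le_add_of_nonneg_right (by positivity)
  | vert =>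
    refine ⟨1, zero_le_one, fun ξ ζ hζ => ?_⟩
    rw [one_mul, Real.sq_sqrt yinSize_nonneg]
    have := norm_nonneg (Ellipsoid.hessU ξ ζ)
    have := norm_nonneg (kap p ζ * Ellipsoid.hessU ξ ζ)
    have := sq_nonneg ‖Ellipsoid.gamma p ξ ζ‖
    unfold yinSize; linarith
  | kap_mul_hessU =>
    refine ⟨1, zero_le_one, fun ξ ζ hζ => ?_⟩
    rw [one_mul, Real.sq_sqrt yinSize_nonneg]
    have := norm_nonneg (Ellipsoid.hessU ξ ζ)
    have := norm_nonneg (Ellipsoid.vert p ξ ζ)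
    have := sq_nonneg ‖Ellipsoid.gamma p ξ ζ‖
    unfold yinSize; linarith
  | kap_mul_beta_sq =>
    refine ⟨1, zero_le_one, fun ξ ζ hζ => ?_⟩
    rw [one_mul, Real.sq_sqrt yinSize_nonneg, norm_mul, norm_pow]
    have := mul_le_mul_of_nonneg_left (norm_beta_sq_le (ξ := ξ) hζ) (norm_nonneg (kap p ζ))
    have := norm_nonneg (Ellipsoid.hessU ξ ζ)
    have := norm_nonneg (Ellipsoid.vert p ξ ζ)
    have := sq_nonneg ‖Ellipsoid.gamma p ξ ζ‖
    rw [yinSize, norm_mul]; linarith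
  | conj _ ih => simpa only [norm_star] using ih
  | const_mul c _ ih =>
    obtain ⟨C, hC, h⟩ := ih
    refine ⟨‖c‖ * C, by positivity, fun ξ ζ hζ => ?_⟩
    rw [norm_mul, mul_assoc]
    exact mul_le_mul_of_nonneg_left (h ξ ζ hζ) (norm_nonneg c)
  | add _ _ ih₁ ih₂ =>
    obtain ⟨C, hC, h⟩ := ih₁
    obtain ⟨C', hC', h'⟩ := ih₂
    refine ⟨C + C', by positivity, fun ξ ζ hζ => ?_⟩
    rw [add_mul]
    exact (norm_add_le _ _).trans (add_le_add (h ξ ζ hζ) (h' ξ ζ hζ))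
  | mul _ _ hl ih₁ ih₂ =>
    obtain ⟨C, hC, h⟩ := ih₁
    obtain ⟨C', hC', h'⟩ := ih₂
    refine ⟨C * C', by positivity, fun ξ ζ hζ => ?_⟩
    rw [norm_mul, ← hl, pow_add, mul_mul_mul_comm]
    exact mul_le_mul (h ξ ζ hζ) (h' ξ ζ hζ) (norm_nonneg _) (by positivity)

/-- If the `ℂ^n`-component of `ξ` is non-zero, `hessU` is positive. Otherwise `beta` vanishes and
`vert` reduces to a positive multiple of `innerW ξ ξ`. -/
theorem yinSize_pos (hζ : ζ ∈ yinDomain m n p) (hξ : ξ ≠ 0) : 0 < yinSize p ξ ζ := by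
  by_cases hz : innerZ ξ ξ = 0
  · have h1 : ∀ i, ξ (Sum.inl i) = 0 := fun i => by
      have := (Finset.sum_eq_zero_iff_of_nonneg fun _ _ => mul_star_self_nonneg _).1 hz i
      simpa using this
    have hw : innerW ξ ξ ≠ 0 := fun hw => hξ <| funext fun i => by
      cases i with
      | inl i => exact h1 i
      | inr j =>
        have := (Finset.sum_eq_zero_iff_of_nonneg fun _ _ => mul_star_self_nonneg _).1 hw j
        simpa using this
    have hb : beta ξ ζ = 0 := by simp [beta, innerZ, h1]
    have hv : vert p ξ ζ ≠ 0 := by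
      simp only [vert, hb, star_zero, mul_zero, zero_mul, add_zero]
      exact mul_ne_zero (mul_ne_zero (zPow_pos hζ).ne' hw) (one_sub_yinX_inv_pos hζ).ne'
    have := norm_pos_iff.2 hv
    unfold yinSize; positivity
  · have hu : hessU ξ ζ ≠ 0 := ne_of_gt <| add_pos_of_pos_of_nonneg
      (mul_pos (lt_of_le_of_ne innerZ_self_nonneg (Ne.symm hz)) (one_sub_innerZ_inv_pos hζ))
      (mul_star_self_nonneg _)
    have := norm_pos_iff.2 hu
    unfold yinSize; positivity

end Graded

/-! ### The ellipsoid, the potential and its complex Hessian. -/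

section Potential

variable {m n : ℕ} {p lam : ℝ} {ξ ζ : Fin n ⊕ Fin m → ℂ}

/-- The squared length of `ξ` for the metric with potential
`-lam * log (1 - X) - N * log (1 - |z|²)`. -/
def yinLength (p lam N : ℝ) (ξ ζ : Fin n ⊕ Fin m → ℂ) : ℂ :=
  lam * (vert p ξ ζ + (p : ℂ)⁻¹ * (kap p ζ * hessU ξ ζ) + gamma p ξ ζ * star (gamma p ξ ζ)) +
    N * hessU ξ ζ

theorem yinPoly_yinLength (N : ℝ) : YinPoly m n p 2 (yinLength p lam N) :=
  (((YinPoly.vert.add (YinPoly.kap_mul_hessU.const_mul _)).add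
    (YinPoly.gamma.mul YinPoly.gamma.conj rfl)).const_mul _).add (YinPoly.hessU.const_mul _)

theorem exists_yinLength_eq (hp : 0 < p) (hlam : 0 < lam) {N : ℝ} (hN : 0 < N) :
    ∃ c : ℝ, 0 < c ∧ ∀ ξ, ∀ ζ ∈ yinDomain m n p, ∃ G : ℝ,
      yinLength p lam N ξ ζ = G ∧ c * yinSize p ξ ζ ≤ G := by
  -- The constant is the least of the coefficients `N`, `λ`, `λ / p` of the nonnegative summands of
  -- `yinLength`; each summand equals its norm.
  refine ⟨min N (lam * min 1 p⁻¹), by positivity, fun ξ ζ hζ =>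
    ⟨lam * (‖vert p ξ ζ‖ + p⁻¹ * ‖kap p ζ * hessU ξ ζ‖ + ‖gamma p ξ ζ‖ ^ 2) + N * ‖hessU ξ ζ‖,
      ?_, ?_⟩⟩
  · have h1 := Complex.eq_coe_norm_of_nonneg (vert_nonneg (ξ := ξ) hζ)
    have h2 := Complex.eq_coe_norm_of_nonneg (hessU_nonneg (ξ := ξ) hζ)
    have h3 := Complex.eq_coe_norm_of_nonneg (mul_nonneg (kap_nonneg hζ) (hessU_nonneg (ξ := ξ) hζ))
    have h4 : gamma p ξ ζ * star (gamma p ξ ζ) = (‖gamma p ξ ζ‖ : ℂ) ^ 2 := Complex.mul_conj' _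
    push_cast
    rw [yinLength, h4, ← h1, ← h2, ← h3]
  · have hM : 0 < min 1 p⁻¹ := by positivity
    have h1 : lam * min 1 p⁻¹ ≤ lam := mul_le_of_le_one_right hlam.le (min_le_left _ _)
    have h2 : lam * min 1 p⁻¹ ≤ lam * p⁻¹ := mul_le_mul_of_nonneg_left (min_le_right _ _) hlam.le
    have e1 := mul_le_mul_of_nonneg_right ((min_le_right N _).trans h1) (norm_nonneg (vert p ξ ζ))
    have e2 := mul_le_mul_of_nonneg_right ((min_le_right N _).trans h2)
      (norm_nonneg (kap p ζ * hessU ξ ζ))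
    have e3 := mul_le_mul_of_nonneg_right ((min_le_right N _).trans h1)
      (sq_nonneg ‖gamma p ξ ζ‖)
    have e4 := mul_le_mul_of_nonneg_right (min_le_left N (lam * min 1 p⁻¹))
      (norm_nonneg (hessU ξ ζ))
    rw [yinSize]; linarith

theorem ellipsoid_eq_yinDomain (m n : ℕ) {p : ℝ} (hp : 0 < p) :
    ellipsoid m n p = yinDomain m n p := by
  ext ζ
  have hw : 0 ≤ normW ζ := norm_nonneg _
  have h0 : normZ ζ ^ 2 < 1 → (normW ζ ^ (2 * p) < 1 - normZ ζ ^ 2 ↔ yinX p ζ < 1) := by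
    intro h
    have hs : 0 < 1 - normZ ζ ^ 2 := sub_pos.2 h
    have e1 : normW ζ ^ (2 * p) = (normW ζ ^ 2) ^ p := by
      rw [Real.rpow_mul hw, Real.rpow_two]
    rw [yinX, neg_div, Real.rpow_neg hs.le, ← div_eq_mul_inv,
      div_lt_one (Real.rpow_pos_of_pos hs _), e1, one_div,
      Real.lt_rpow_inv_iff_of_pos (sq_nonneg _) hs.le hp]
  constructor
  · intro h
    have h' : normZ ζ ^ 2 + normW ζ ^ (2 * p) < 1 := h
    have h1 : normZ ζ ^ 2 < 1 := by linarith [Real.rpow_nonneg hw (2 * p)]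
    exact ⟨h1, (h0 h1).1 (by linarith)⟩
  · rintro ⟨h1, h2⟩
    have := (h0 h1).2 h2
    show normZ ζ ^ 2 + normW ζ ^ (2 * p) < 1
    linarith

theorem contDiff_normZ_sq : ContDiff ℝ ∞ fun ζ : Fin n ⊕ Fin m → ℂ => normZ ζ ^ 2 := by
  simp only [normZ, EuclideanSpace.norm_sq_eq]
  exact ContDiff.sum fun i _ => (contDiff_apply ℝ ℂ (Sum.inl i)).norm_sq ℝ

theorem contDiff_normW_sq : ContDiff ℝ ∞ fun ζ : Fin n ⊕ Fin m → ℂ => normW ζ ^ 2 := by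
  simp only [normW, EuclideanSpace.norm_sq_eq]
  exact ContDiff.sum fun i _ => (contDiff_apply ℝ ℂ (Sum.inr i)).norm_sq ℝ

theorem isOpen_ellipsoid (hp : 0 < p) : IsOpen (ellipsoid m n p) := by
  refine isOpen_lt (contDiff_normZ_sq.continuous.add ?_) continuous_const
  refine Continuous.rpow_const ?_ fun _ => Or.inr (by positivity)
  exact ((PiLp.continuous_toLp 2 _).comp (by fun_prop)).norm

theorem yinPotential_eq (hζ : ζ ∈ yinDomain m n p) :
    yinPotential m n p lam ζ = -lam * Real.log (1 - yinX p ζ) +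
      -(((n + 1 : ℝ) * p + m) / p) * Real.log (1 - normZ ζ ^ 2) := by
  have h1 := sub_pos.2 hζ.1
  have h2 := sub_pos.2 hζ.2
  rw [yinPotential, yinK, Real.log_mul (Real.rpow_pos_of_pos h2 _).ne'
    (Real.rpow_pos_of_pos h1 _).ne', Real.log_rpow h2, Real.log_rpow h1]

theorem contDiffOn_yinPotential : ContDiffOn ℝ ∞ (yinPotential m n p lam) (yinDomain m n p) := by
  refine ContDiffOn.congr ?_ fun ζ hζ => yinPotential_eq hζ
  have h1 : ContDiffOn ℝ ∞ (fun ζ : Fin n ⊕ Fin m → ℂ => 1 - normZ ζ ^ 2) (yinDomain m n p) :=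
    (contDiff_const.sub contDiff_normZ_sq).contDiffOn
  have h2 : ContDiffOn ℝ ∞ (fun ζ : Fin n ⊕ Fin m → ℂ => 1 - yinX p ζ) (yinDomain m n p) :=
    contDiffOn_const.sub (contDiff_normW_sq.contDiffOn.mul
      (h1.rpow_const_of_ne fun ζ hζ => (sub_pos.2 hζ.1).ne'))
  exact (contDiffOn_const.mul (h2.log fun ζ hζ => (sub_pos.2 hζ.2).ne')).add
    (contDiffOn_const.mul (h1.log fun ζ hζ => (sub_pos.2 hζ.1).ne'))

theorem hasWirt_log_one_sub_yinX (hζ : ζ ∈ yinDomain m n p) :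
    HasWirt ξ (fun x => (Real.log (1 - yinX p x) : ℂ)) (-gamma p ξ ζ) (-star (gamma p ξ ζ)) ζ := by
  have h0 := one_sub_yinX_ne_zero hζ
  have h1 : HasWirt ξ (fun x => ((1 - yinX p x : ℝ) : ℂ))
      (0 - gamma p ξ ζ * (1 - (yinX p ζ : ℂ)))
      (0 - star (gamma p ξ ζ) * (1 - (yinX p ζ : ℂ))) ζ := by
    refine ((HasWirt.const 1).sub (hasWirt_yinX hζ)).congr (.of_forall fun x => ?_)
    simp only [Complex.ofReal_sub, Complex.ofReal_one]
  refine (h1.real_comp (Real.hasDerivAt_log (sub_pos.2 hζ.2).ne')).of_eq ?_ ?_ <;>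
  · push_cast; field_simp; ring

theorem hasWirt_log_one_sub_normZ (hζ : ζ ∈ yinDomain m n p) :
    HasWirt ξ (fun x => (Real.log (1 - normZ x ^ 2) : ℂ)) (-beta ξ ζ) (-star (beta ξ ζ)) ζ := by
  have h1 : HasWirt ξ (fun x => ((1 - normZ x ^ 2 : ℝ) : ℂ)) (0 - innerZ ξ ζ)
      (0 - innerZ ζ ξ) ζ := by
    refine ((HasWirt.const 1).sub hasWirt_innerZ_self).congr (.of_forall fun x => ?_)
    simp only [Complex.ofReal_sub, Complex.ofReal_one, ofReal_normZ_sq]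
  refine (h1.real_comp (Real.hasDerivAt_log (sub_pos.2 hζ.1).ne')).of_eq ?_ ?_
  · rw [Complex.ofReal_inv, Complex.ofReal_sub, ofReal_normZ_sq, Complex.ofReal_one, beta]; ring
  · rw [Complex.ofReal_inv, Complex.ofReal_sub, ofReal_normZ_sq, Complex.ofReal_one, star_beta]
    ring

theorem wirtDir_wirtBarDir_yinPotential (hΩ : IsOpen (yinDomain m n p))
    (hζ : ζ ∈ yinDomain m n p) :
    wirtDir ξ (wirtBarDir ξ fun x => (yinPotential m n p lam x : ℂ)) ζ =
      yinLength p lam (((n + 1 : ℝ) * p + m) / p) ξ ζ := by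
  set N : ℝ := ((n + 1 : ℝ) * p + m) / p with hN
  have h1 : ∀ x ∈ yinDomain m n p, wirtBarDir ξ (fun x => (yinPotential m n p lam x : ℂ)) x =
      lam * star (gamma p ξ x) + N * star (beta ξ x) := by
    intro x hx
    refine ((((hasWirt_log_one_sub_yinX (ξ := ξ) hx).const_mul (-lam : ℂ)).add
      ((hasWirt_log_one_sub_normZ hx).const_mul (-N : ℂ))).congr
      (Filter.eventually_of_mem (hΩ.mem_nhds hx) fun y hy => ?_)).wirtBarDir_eq.trans (by ring)
    rw [yinPotential_eq hy, ← hN]; push_cast; rfl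
  -- Conjugation turns the `(0, 1)`-derivative of `gamma` into the `(1, 0)`-derivative of its
  -- conjugate; all terms are real, so the conjugate is dropped below.
  rw [wirtDir_congr (Filter.eventually_of_mem (hΩ.mem_nhds hζ) h1),
    (((hasWirt_gamma hζ).conj.const_mul (lam : ℂ)).add
      ((hasWirt_star_beta hζ).const_mul (N : ℂ))).wirtDir_eq, yinLength]
  have h2 : star (vert p ξ ζ) = vert p ξ ζ := (IsSelfAdjoint.of_nonneg (vert_nonneg hζ)).star_eq
  have h3 : star (kap p ζ) = kap p ζ := (IsSelfAdjoint.of_nonneg (kap_nonneg hζ)).star_eq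
  simp only [star_add, star_mul', star_star, h2, h3, star_hessU, star_ofReal_inv]
  ring

end Potential

end Ellipsoid

end

/-! ### The curvature bound. -/

theorem mainTheorem11 (m n : ℕ) (p : ℝ) (hp : 0 < p) (lam : ℝ) (hlam : 0 < lam) :
    Ellipsoid.IsKahlerPotentialOn (Ellipsoid.yinPotential m n p lam)
        (Ellipsoid.ellipsoid m n p) ∧
      ∃ D : ℝ, 0 < D ∧ ∀ ζ ∈ Ellipsoid.ellipsoid m n p, ∀ ξ : Fin n ⊕ Fin m → ℂ, ξ ≠ 0 →
        -D ≤ Ellipsoid.holSectCurvature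
          (Ellipsoid.metric (Ellipsoid.yinPotential m n p lam)) ζ ξ := by
  have hΩ := Ellipsoid.isOpen_ellipsoid (m := m) (n := n) hp
  rw [Ellipsoid.ellipsoid_eq_yinDomain m n hp] at hΩ ⊢
  set N : ℝ := ((n + 1 : ℝ) * p + m) / p with hN
  have hs : ∀ ξ, ∀ ζ ∈ Ellipsoid.yinDomain m n p,
      Ellipsoid.sqLength (Ellipsoid.metric (Ellipsoid.yinPotential m n p lam)) ζ ξ =
        Ellipsoid.yinLength p lam N ξ ζ := fun ξ ζ hζ => by
    rw [Ellipsoid.sqLength_metric hΩ Ellipsoid.contDiffOn_yinPotential hζ,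
      Ellipsoid.wirtDir_wirtBarDir_yinPotential hΩ hζ]
  obtain ⟨c, hc, hG⟩ := Ellipsoid.exists_yinLength_eq (m := m) (n := n) hp hlam
    (N := N) (by positivity)
  have hK : Ellipsoid.IsKahlerPotentialOn (Ellipsoid.yinPotential m n p lam)
      (Ellipsoid.yinDomain m n p) := by
    refine ⟨Ellipsoid.contDiffOn_yinPotential, fun ζ hζ =>
      Ellipsoid.posDef_of_sqLength_pos _ _ fun ξ hξ => ?_⟩
    obtain ⟨G, h1, h2⟩ := hG ξ ζ hζ
    rw [hs ξ ζ hζ, h1]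
    exact Complex.zero_lt_real.2 ((mul_pos hc (Ellipsoid.yinSize_pos hζ hξ)).trans_le h2)
  refine ⟨hK, ?_⟩
  -- `F` is the `(0, 1)`-derivative of `g(ξ, ξ̄)` and `H` the `(1, 0)`-derivative of `F`, so `H` has
  -- weight `2 + 1 + 1`.
  obtain ⟨_, F, _, hF, hF1⟩ := (Ellipsoid.yinPoly_yinLength (m := m) (n := n) (p := p)
    (lam := lam) N).exists_hasWirt
  obtain ⟨H, _, hH, _, hH1⟩ := hF.exists_hasWirt
  obtain ⟨C, hC, hH2⟩ := hH.exists_bound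
  -- The curvature is at least `-2 C / c²`; the added `1` gives `D > 0` even when `C = 0`.
  refine ⟨2 * (C / c ^ 2) + 1, by positivity, fun ζ hζ ξ hξ => ?_⟩
  obtain ⟨G, h1, h2⟩ := hG ξ ζ hζ
  have hQ := Ellipsoid.yinSize_pos hζ hξ
  have h3 : Ellipsoid.wirtDir ξ (Ellipsoid.wirtBarDir ξ fun x => Ellipsoid.sqLength
      (Ellipsoid.metric (Ellipsoid.yinPotential m n p lam)) x ξ) ζ = H ξ ζ := by
    rw [← (hH1 ξ ζ hζ).wirtDir_eq]
    refine Ellipsoid.wirtDir_congr (Filter.eventually_of_mem (hΩ.mem_nhds hζ) fun x hx => ?_)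
    rw [← (hF1 ξ x hx).wirtBarDir_eq]
    exact Ellipsoid.wirtBarDir_congr (Filter.eventually_of_mem (hΩ.mem_nhds hx)
      fun y hy => hs ξ y hy)
  have h4 : ‖H ξ ζ‖ ≤ C / c ^ 2 * G ^ 2 := by
    refine (hH2 ξ ζ hζ).trans ?_
    have e : √(Ellipsoid.yinSize p ξ ζ) ^ (2 + 1 + 1) = Ellipsoid.yinSize p ξ ζ ^ 2 := by
      rw [show 2 + 1 + 1 = 2 * 2 from rfl, pow_mul, Real.sq_sqrt hQ.le]
    have e2 : (c * Ellipsoid.yinSize p ξ ζ) ^ 2 ≤ G ^ 2 := by gcongr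
    rw [e, div_mul_eq_mul_div, le_div_iff₀ (by positivity)]
    nlinarith [mul_le_mul_of_nonneg_left e2 hC]
  have := Ellipsoid.le_holSectCurvature hΩ hK hζ ((mul_pos hc hQ).trans_le h2)
    ((hs ξ ζ hζ).trans h1) (h3 ▸ h4)
  linarith
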